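/- **Setting.** For $s\ge 1$, let $\mathcal P_s$ be the set of probability distributions on $\mathbb R$ with finite absolute $s$-th moment. For $\mathrm p\in\mathcal P_{1+r}$, $r\in(0,1)$, write $\mu_{\mathrm p}$ for its mean and $v_r=v_r(\mathrm p)=\mathbb E_{X\sim\mathrm p}|X-\mu_{\mathrm p}|^{1+r}$ for its absolute $(1+r)$-th central moment. Real numbers $X_1,\dots,X_n$ are $\alpha$-contaminated samples of $X_1^*,\dots,X_n^*$ if there are a set $S\subseteq\{1,\dots,n\}$ with $|S|\ge(1-\alpha)n$ and a map $\sigma$ from $\{1,\dots,n\}$ to itself, injective on $S$, with $X_i=X^*_{\sigma(i)}$ for all $i\in S$ (all but at most $\alpha n$ of the samples are, as a multiset, clean samples). Here $X_1^*,\dots,X_n^*$ are i.i.d. from $\mathrm p$, and the random variables $X_1,\dots,X_n$ may depend arbitrarily on all of them. Given $k$, let $I_1,\dots,I_k$ be a uniformly random family of pairwise disjoint subsets of $\{1,\dots,n\}$, each of size $m=\lfloor n/k\rfloor$, independent of the clean and contaminated samples. The median-of-means (MoM) estimator $\widehat\mu_{\mathrm{MoM}}$ is the $\lceil k/2\rceil$-th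 smallest of the block means $\widehat\mu_i=\frac1m\sum_{j\in I_i}X_j$, $i=1,\dots,k$. **Theorem 3.3.** Let $r\in(0,1)$. 1. (Upper bound.) There are a function $C:\mathbb R\to\mathbb R$ and constants $c_1,c_2>0$, depending only on $r$, with $$c_1\left(\tfrac12-\tfrac1\gamma\right)^{-\frac{2r+1}{1+r}}\le C(\gamma)\le c_2\left(\tfrac12-\tfrac1\gamma\right)^{-\frac{2r+1}{1+r}}\qquad\text{for all }\gamma\in(2,2.5],$$ such that for all $\gamma\in(2,2.5]$, all $n$, all $\delta>2\exp(-(1/2-1/\gamma)^2n)$, all $\mathrm p\in\mathcal P_{1+r}$ and all $0\le\alpha\le 0.4$, the MoM estimator with $$k=\max\left\{\left\lceil\frac{\log(2/\delta)}{(1/2-1/\gamma)^2}\right\rceil,\ \lceil\gamma\alpha n\rceil\right\}$$ blocks, evaluated at any $\alpha$-contaminated samples, satisfies $$|\widehat\mu_{\mathrm{MoM}}-\mu_{\mathrm p}|\le C(\gamma)\,v_r^{\frac1{1+r}}\left(\left(\frac{\log(2/\delta)}n\right)^{\frac r{1+r}}+\alpha^{\frac r{1+r}}\right)$$ with probability at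 least $1-\delta$. 2. (Optimality over $\mathcal P_{1+r}$.) There is a constant $c>0$, depending only on $r$, such that for all $n$, all $\delta\in[e^{-n},1/4]$, all $0\le\alpha\le 0.4$, all $v>0$ and every (possibly randomized) estimator $\widehat\mu=\widehat\mu(X_1,\dots,X_n)$ of the mean, there are a distribution $\mathrm p\in\mathcal P_{1+r}$ with $v_r(\mathrm p)=v$ and an adversarial attack, that is, a measurable map $A:\mathbb R^n\to\mathbb R^n$ turning every sample $(X_1^*,\dots,X_n^*)$ into $\alpha$-contaminated samples of it, such that $\widehat\mu$ evaluated at $A(X_1^*,\dots,X_n^*)$ satisfies $$|\widehat\mu-\mu_{\mathrm p}|\ge c\,v^{\frac1{1+r}}\left(\left(\frac{\log(2/\delta)}n\right)^{\frac r{1+r}}+\alpha^{\frac r{1+r}}\right)$$ with probability at least $\delta$. -/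

import Mathlib

open MeasureTheory ProbabilityTheory

namespace MoM

/-- The mean of a distribution on the real line. -/
noncomputable def mean (p : Measure ℝ) : ℝ := ∫ x, x ∂p

/-- The class of probability distributions on the real line with finite absolute `s`-th moment. -/
structure FiniteMoment (s : ℝ) (p : Measure ℝ) : Prop where
  isProbabilityMeasure : IsProbabilityMeasure p
  integrable : Integrable (fun x : ℝ => |x| ^ s) p

/-- The absolute central moment `v_r = E |X - μ_p| ^ (1 + r)`. -/
noncomputable def centralMoment (r : ℝ) (p : Measure ℝ) : ℝ :=
  ∫ x, |x - mean p| ^ (1 + r) ∂p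

/-- The error rate
`v ^ (1 / (1 + r)) * ((log (2 / δ) / n) ^ (r / (1 + r)) + α ^ (r / (1 + r)))`. -/
noncomputable def rate (r v : ℝ) (n : ℕ) (δ α : ℝ) : ℝ :=
  v ^ (1 / (1 + r)) * ((Real.log (2 / δ) / n) ^ (r / (1 + r)) + α ^ (r / (1 + r)))

/-- `x` is an `α`-contamination of the clean sample `xs`: the entries of `x` at some set `S` of at
least `(1 - α) n` indices form a sub-multiset of the entries of `xs`. The matching `σ` of entries
of `x` with entries of `xs` is injective on `S` but may move positions; the remaining entries of
`x` are arbitrary. -/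
def IsContamination {n : ℕ} (α : ℝ) (xs x : Fin n → ℝ) : Prop :=
  ∃ (S : Finset (Fin n)) (σ : Fin n → Fin n),
    (1 - α) * n ≤ S.card ∧ Set.InjOn σ S ∧ ∀ i ∈ S, x i = xs (σ i)

/-- Families of `k` pairwise disjoint blocks of `m` indices in `{0, …, n - 1}`. -/
def Blocks (n k m : ℕ) : Type :=
  {I : Fin k → Finset (Fin n) // (∀ i, (I i).card = m) ∧ Pairwise fun i j => Disjoint (I i) (I j)}

instance (n k m : ℕ) : MeasurableSpace (Blocks n k m) := ⊤

instance (n k m : ℕ) : DiscreteMeasurableSpace (Blocks n k m) := ⟨fun _ => trivial⟩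

noncomputable instance (n k m : ℕ) : Fintype (Blocks n k m) := by
  classical
  unfold Blocks
  infer_instance

/-- The mean of the sample `x` over the `i`-th block. -/
noncomputable def blockMean {n k m : ℕ} (I : Blocks n k m) (x : Fin n → ℝ) (i : Fin k) : ℝ :=
  (∑ j ∈ I.1 i, x j) / m

/-- The `j`-th order statistic (`1 ≤ j ≤ k`): the `j`-th entry of the non-decreasing
rearrangement of `y`. Outside that range the value is irrelevant. -/
noncomputable def orderStatistic {k : ℕ} (y : Fin k → ℝ) (j : ℕ) : ℝ :=
  if h : j - 1 < k then y (Tuple.sort y ⟨j - 1, h⟩) else 0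

/-- The median-of-means estimator: the `⌈k / 2⌉`-th order statistic of the block means. -/
noncomputable def estimator {n k m : ℕ} (I : Blocks n k m) (x : Fin n → ℝ) : ℝ :=
  orderStatistic (blockMean I x) ⌈(k : ℝ) / 2⌉₊

/-- The number of blocks `k = max {⌈log (2 / δ) / (1 / 2 - 1 / γ) ^ 2⌉, ⌈γ α n⌉}`. -/
noncomputable def numBlocks (γ δ α : ℝ) (n : ℕ) : ℕ :=
  max ⌈Real.log (2 / δ) / (1 / 2 - 1 / γ) ^ 2⌉₊ ⌈γ * α * n⌉₊

/-- The data of a mean estimation experiment with `k` random blocks under adversarial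
contamination: `Xs` are i.i.d. samples from `p`, `X` are the contaminated samples (which may depend
on all of `Xs` and on extra randomness), and `I` is a uniformly random family of `k` disjoint
blocks of size `⌊n / k⌋`, drawn independently of the clean and contaminated samples. -/
structure IsExperiment {Ω : Type*} [MeasurableSpace Ω] (P : Measure Ω) (p : Measure ℝ) (α : ℝ)
    {n k : ℕ} (Xs X : Fin n → Ω → ℝ) (I : Ω → Blocks n k (n / k)) : Prop where
  law : ∀ i, HasLaw (Xs i) p P
  indep : iIndepFun Xs P
  aemeasurable : ∀ i, AEMeasurable (X i) P
  contamination : ∀ᵐ ω ∂P, IsContamination α (fun i => Xs i ω) (fun i => X i ω)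
  blocks_law : HasLaw I (uniformOn Set.univ) P
  blocks_indep : IndepFun (fun ω => (fun i => Xs i ω, fun i => X i ω)) I P

end MoM

/-!
Upper bound. The von Bahr–Esseen inequality bounds the `(1 + r)`-th moment of a clean block sum, so
by Markov's inequality each clean block mean is far from the mean with probability at most `ε / 4`,
where `ε = 1 / 2 - 1 / γ`. The blocks being disjoint, Hoeffding's inequality leaves at most `ε k`
far blocks outside an event of probability `exp (-ε² k)`. Contamination spoils at most
`α n ≤ k / γ` further blocks, which is less than what is needed to move the median. As the
contaminated sample may be a permuted clean one, chosen with knowledge of the clean sample, this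
count is averaged over all families of blocks, an average which does not change under permutations.

Lower bound. For `a > 0`, the distributions with mass `q` at `±a` and mass `1 - q` at `0` have the
same central moment. For a suitable `q`, the adversary who replaces the sample by `0` whenever the
contamination budget allows it succeeds with probability at least `2 δ`. The estimator then cannot
distinguish the means `± q a`, and errs by at least `q a` with probability at least `1 / 2` for one
of the two signs.
-/

namespace MoM

section SignedPower

variable {r : ℝ}

/-- The odd power function `x ↦ sign x * |x| ^ r`, the derivative of `|x| ^ (1 + r)` up to the
factor `1 + r`. The product form is the one in which Mathlib computes that derivative. -/
noncomputable def signedRpow (r x : ℝ) : ℝ := x * |x| ^ (r - 1)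

@[fun_prop]
lemma measurable_signedRpow : Measurable (signedRpow r) := by
  unfold signedRpow; fun_prop

lemma signedRpow_neg (x : ℝ) : signedRpow r (-x) = -signedRpow r x := by
  simp only [signedRpow, abs_neg, neg_mul]

lemma signedRpow_of_nonneg (hr : r ≠ 0) {x : ℝ} (hx : 0 ≤ x) : signedRpow r x = x ^ r := by
  rcases hx.eq_or_lt with rfl | hx
  · simp [signedRpow, hr]
  · rw [signedRpow, abs_of_pos hx, Real.rpow_sub_one hx.ne', mul_div_cancel₀ _ hx.ne']

lemma abs_signedRpow (hr : r ≠ 0) (x : ℝ) : |signedRpow r x| = |x| ^ r := by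
  rw [← signedRpow_of_nonneg hr (abs_nonneg x), signedRpow, signedRpow, abs_mul, abs_abs,
    abs_of_nonneg (Real.rpow_nonneg (abs_nonneg x) _)]

lemma abs_signedRpow_sub_le_of_nonneg (hr0 : 0 < r) (hr1 : r ≤ 1) {x y : ℝ} (hy : 0 ≤ y)
    (hyx : y ≤ x) : |signedRpow r x - signedRpow r y| ≤ |x - y| ^ r := by
  have hxy : 0 ≤ x - y := sub_nonneg.2 hyx
  have hsub := Real.rpow_add_le_add_rpow hy hxy hr0.le hr1
  rw [add_sub_cancel] at hsub
  rw [signedRpow_of_nonneg hr0.ne' hy, signedRpow_of_nonneg hr0.ne' (hy.trans hyx),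
    abs_of_nonneg hxy, abs_of_nonneg (sub_nonneg.2 (Real.rpow_le_rpow hy hyx hr0.le))]
  linarith

lemma abs_signedRpow_sub_le (hr0 : 0 < r) (hr1 : r ≤ 1) (x y : ℝ) :
    |signedRpow r x - signedRpow r y| ≤ 2 * |x - y| ^ r := by
  wlog hyx : y ≤ x generalizing x y
  · rw [abs_sub_comm, abs_sub_comm x y]
    exact this y x (le_of_not_ge hyx)
  have hdist : 0 ≤ |x - y| ^ r := by positivity
  rcases le_total 0 y with hy | hy
  · linarith [abs_signedRpow_sub_le_of_nonneg hr0 hr1 hy hyx]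
  rcases le_total x 0 with hx | hx
  · have hneg := abs_signedRpow_sub_le_of_nonneg hr0 hr1 (neg_nonneg.2 hx) (neg_le_neg hyx)
    rw [signedRpow_neg, signedRpow_neg, neg_sub_neg, neg_sub_neg] at hneg
    linarith
  · have habs : |x - y| = x - y := abs_of_nonneg (sub_nonneg.2 hyx)
    have hxr : |x| ^ r ≤ |x - y| ^ r :=
      Real.rpow_le_rpow (abs_nonneg x) (by rw [habs, abs_of_nonneg hx]; linarith) hr0.le
    have hyr : |y| ^ r ≤ |x - y| ^ r :=
      Real.rpow_le_rpow (abs_nonneg y) (by rw [habs, abs_of_nonpos hy]; linarith) hr0.le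
    calc |signedRpow r x - signedRpow r y|
        ≤ |signedRpow r x| + |signedRpow r y| := abs_sub _ _
      _ = |x| ^ r + |y| ^ r := by rw [abs_signedRpow hr0.ne', abs_signedRpow hr0.ne']
      _ ≤ 2 * |x - y| ^ r := by linarith

lemma hasDerivAt_abs_rpow_one_add (hr : 0 < r) (x : ℝ) :
    HasDerivAt (fun t : ℝ => |t| ^ (1 + r)) ((1 + r) * signedRpow r x) x := by
  refine (hasDerivAt_abs_rpow x (by linarith)).congr_deriv ?_
  rw [signedRpow, show 1 + r - 2 = r - 1 by ring]
  ring

lemma abs_add_rpow_le (hr0 : 0 < r) (hr1 : r ≤ 1) (a b : ℝ) :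
    |a + b| ^ (1 + r) ≤ |a| ^ (1 + r) + (1 + r) * signedRpow r a * b + 4 * |b| ^ (1 + r) := by
  have hr : 0 < 1 + r := by linarith
  let g (t : ℝ) : ℝ := |t| ^ (1 + r) - (1 + r) * signedRpow r a * t
  have hderiv (t : ℝ) : HasDerivAt g ((1 + r) * (signedRpow r t - signedRpow r a)) t := by
    refine ((hasDerivAt_abs_rpow_one_add hr0 t).sub
      ((hasDerivAt_id t).const_mul ((1 + r) * signedRpow r a))).congr_deriv ?_
    ring
  have hbound : ∀ t ∈ Set.uIcc a (a + b),
      ‖(1 + r) * (signedRpow r t - signedRpow r a)‖ ≤ 4 * |b| ^ r := by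
    intro t ht
    have hta : |t - a| ≤ |b| := by simpa using Set.abs_sub_left_of_mem_uIcc ht
    calc ‖(1 + r) * (signedRpow r t - signedRpow r a)‖
        = (1 + r) * |signedRpow r t - signedRpow r a| := by
          rw [norm_mul, Real.norm_eq_abs, Real.norm_eq_abs, abs_of_pos hr]
      _ ≤ 2 * (2 * |t - a| ^ r) := by
          gcongr
          · linarith
          · exact abs_signedRpow_sub_le hr0 hr1 t a
      _ ≤ 2 * (2 * |b| ^ r) := by gcongr
      _ = 4 * |b| ^ r := by ring
  have hmvt : g (a + b) - g a ≤ 4 * |b| ^ r * |b| := by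
    have h := (convex_uIcc a (a + b)).norm_image_sub_le_of_norm_hasDerivWithin_le
      (fun t _ => (hderiv t).hasDerivWithinAt) hbound Set.left_mem_uIcc Set.right_mem_uIcc
    rw [add_sub_cancel_left] at h
    exact (le_abs_self _).trans h
  have hpow : |b| ^ (1 + r) = |b| ^ r * |b| := by
    rw [Real.rpow_add' (abs_nonneg b) hr.ne', Real.rpow_one, mul_comm]
  simp only [g] at hmvt
  rw [hpow]
  linarith

end SignedPower

section Moments

variable {Ω : Type*} [MeasurableSpace Ω] {P : Measure Ω}

lemma integrable_abs_rpow_iff_memLp {s : ℝ} (hs : 0 < s) {X : Ω → ℝ}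
    (hX : AEStronglyMeasurable X P) :
    Integrable (fun ω => |X ω| ^ s) P ↔ MemLp X (ENNReal.ofReal s) P := by
  have h := integrable_norm_rpow_iff hX (by simpa using hs) (ENNReal.ofReal_ne_top (r := s))
  rwa [ENNReal.toReal_ofReal hs.le] at h

lemma integrable_abs_rpow {s : ℝ} (hs : 0 < s) {X : Ω → ℝ}
    (hX : MemLp X (ENNReal.ofReal s) P) : Integrable (fun ω => |X ω| ^ s) P :=
  (integrable_abs_rpow_iff_memLp hs hX.1).2 hX

lemma integrable_of_memLp_one_add [IsFiniteMeasure P] {r : ℝ} (hr : 0 ≤ r) {X : Ω → ℝ}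
    (hX : MemLp X (ENNReal.ofReal (1 + r)) P) : Integrable X P :=
  hX.integrable (by simpa using hr)

lemma integrable_signedRpow_comp [IsFiniteMeasure P] {r : ℝ} (hr : 0 < r) {S : Ω → ℝ}
    (hS : MemLp S (ENNReal.ofReal (1 + r)) P) : Integrable (fun ω => signedRpow r (S ω)) P := by
  have hrpow : Integrable (fun ω => |S ω| ^ r) P :=
    integrable_norm_rpow_of_le hS.1 hr.le (by linarith) (by linarith)
      (integrable_abs_rpow (by linarith) hS)
  refine hrpow.mono' (measurable_signedRpow.comp_aemeasurable hS.aemeasurable).aestronglyMeasurable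
    (.of_forall fun ω => ?_)
  rw [Real.norm_eq_abs, abs_signedRpow hr.ne']

lemma integral_abs_add_rpow_le [IsFiniteMeasure P] {r : ℝ} (hr0 : 0 < r) (hr1 : r ≤ 1)
    {S X : Ω → ℝ} (hSX : IndepFun S X P) (hS : MemLp S (ENNReal.ofReal (1 + r)) P)
    (hX : MemLp X (ENNReal.ofReal (1 + r)) P) (hX0 : ∫ ω, X ω ∂P = 0) :
    ∫ ω, |S ω + X ω| ^ (1 + r) ∂P ≤
      ∫ ω, |S ω| ^ (1 + r) ∂P + 4 * ∫ ω, |X ω| ^ (1 + r) ∂P := by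
  have hr : 0 < 1 + r := by linarith
  have hSI := integrable_abs_rpow hr hS
  have hXI := integrable_abs_rpow hr hX
  have hφ := integrable_signedRpow_comp hr0 hS
  have hX1 := integrable_of_memLp_one_add hr0.le hX
  have hindep : IndepFun (fun ω => signedRpow r (S ω)) X P :=
    hSX.comp measurable_signedRpow measurable_id
  have hcross : Integrable (fun ω => (1 + r) * (signedRpow r (S ω) * X ω)) P :=
    (hindep.integrable_mul hφ hX1).const_mul _
  have hcross0 : ∫ ω, (1 + r) * (signedRpow r (S ω) * X ω) ∂P = 0 := by
    rw [integral_const_mul, hindep.integral_fun_mul_eq_mul_integral hφ.1 hX1.1, hX0, mul_zero,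
      mul_zero]
  calc ∫ ω, |S ω + X ω| ^ (1 + r) ∂P
      ≤ ∫ ω, (|S ω| ^ (1 + r) + (1 + r) * (signedRpow r (S ω) * X ω)
          + 4 * |X ω| ^ (1 + r)) ∂P := by
        refine integral_mono (integrable_abs_rpow hr (hS.add hX))
          ((hSI.add hcross).add (hXI.const_mul 4)) fun ω => ?_
        simpa only [mul_assoc] using abs_add_rpow_le hr0 hr1 (S ω) (X ω)
    _ = ∫ ω, |S ω| ^ (1 + r) ∂P + 4 * ∫ ω, |X ω| ^ (1 + r) ∂P := by
        rw [integral_add (f := fun ω => |S ω| ^ (1 + r) + (1 + r) * (signedRpow r (S ω) * X ω))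
          (hSI.add hcross) (hXI.const_mul 4), integral_add hSI hcross, hcross0,
          integral_const_mul, add_zero]

/-- The **von Bahr–Esseen inequality**. -/
theorem integral_abs_sum_rpow_le {ι : Type*} {r : ℝ} (hr0 : 0 < r)
    (hr1 : r ≤ 1) {X : ι → Ω → ℝ} (hindep : iIndepFun X P)
    (hX : ∀ i, MemLp (X i) (ENNReal.ofReal (1 + r)) P) (hX0 : ∀ i, ∫ ω, X i ω ∂P = 0)
    (s : Finset ι) :
    ∫ ω, |∑ i ∈ s, X i ω| ^ (1 + r) ∂P ≤ 4 * ∑ i ∈ s, ∫ ω, |X i ω| ^ (1 + r) ∂P := by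
  classical
  have : IsProbabilityMeasure P := hindep.isProbabilityMeasure
  induction s using Finset.induction_on with
  | empty => simp [(by linarith : 1 + r ≠ 0)]
  | insert i s hi ih =>
    have hsum : IndepFun (fun ω => ∑ j ∈ s, X j ω) (X i) P := by
      simpa only [← Finset.sum_apply] using
        hindep.indepFun_finsetSum_of_notMem₀ (fun j => (hX j).aemeasurable) hi
    have hstep := integral_abs_add_rpow_le hr0 hr1 hsum (memLp_finsetSum s fun j _ => hX j)
      (hX i) (hX0 i)
    simp_rw [Finset.sum_insert hi, add_comm (X i _)]
    linarith

lemma measureReal_lt_abs_le [IsFiniteMeasure P] {s : ℝ} (hs : 0 < s) {T : Ω → ℝ}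
    (hT : MemLp T (ENNReal.ofReal s) P) {B η : ℝ} (hB : 0 ≤ B) (hη : 0 ≤ η)
    (h : ∫ ω, |T ω| ^ s ∂P ≤ η * B ^ s) : P.real {ω | B < |T ω|} ≤ η := by
  have hTI := integrable_abs_rpow hs hT
  have hnonneg : 0 ≤ᵐ[P] fun ω => |T ω| ^ s := .of_forall fun ω => by positivity
  rcases hB.eq_or_lt with rfl | hB
  · rw [Real.zero_rpow hs.ne', mul_zero] at h
    have hzero : (fun ω => |T ω| ^ s) =ᵐ[P] 0 :=
      (integral_eq_zero_iff_of_nonneg_ae hnonneg hTI).1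
        (le_antisymm h (integral_nonneg_of_ae hnonneg))
    have hnull : P {ω | 0 < |T ω|} = 0 :=
      measure_mono_null (fun ω (hω : 0 < |T ω|) => (Real.rpow_pos_of_pos hω s).ne')
        (ae_iff.1 hzero)
    rwa [measureReal_def, hnull, ENNReal.toReal_zero]
  · have hBs : 0 < B ^ s := Real.rpow_pos_of_pos hB s
    refine le_of_mul_le_mul_left ?_ hBs
    calc B ^ s * P.real {ω | B < |T ω|}
        ≤ B ^ s * P.real {ω | B ^ s ≤ |T ω| ^ s} := by
          refine mul_le_mul_of_nonneg_left (measureReal_mono fun ω hω => ?_) hBs.le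
          exact Real.rpow_le_rpow hB.le (le_of_lt hω) hs.le
      _ ≤ ∫ ω, |T ω| ^ s ∂P := mul_meas_ge_le_integral_of_nonneg hnonneg hTI _
      _ ≤ B ^ s * η := by linarith

end Moments

section FarEntries

/-- The indices of the entries of `y` that are further than `B` from `μ`. -/
noncomputable def farEntries {k : ℕ} (y : Fin k → ℝ) (μ B : ℝ) : Finset (Fin k) :=
  Finset.univ.filter fun i => B < |y i - μ|

lemma mem_farEntries {k : ℕ} {y : Fin k → ℝ} {μ B : ℝ} {i : Fin k} :
    i ∈ farEntries y μ B ↔ B < |y i - μ| := by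
  simp [farEntries]

lemma min_le_card_farEntries {k : ℕ} (y : Fin k → ℝ) {μ B : ℝ} (j : Fin k)
    (h : B < |y (Tuple.sort y j) - μ|) :
    min (j + 1 : ℕ) (k - j) ≤ (farEntries y μ B).card := by
  have hsort : Monotone fun i => y (Tuple.sort y i) := Tuple.monotone_sort y
  have hcard (T : Finset (Fin k)) (hT : ∀ i ∈ T, B < |y (Tuple.sort y i) - μ|) :
      T.card ≤ (farEntries y μ B).card :=
    Finset.card_le_card_of_injOn (Tuple.sort y) (fun i hi => mem_farEntries.2 (hT i hi))
      (Tuple.sort y).injective.injOn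
  rcases lt_abs.1 h with habove | hbelow
  · refine (min_le_right _ _).trans (Fin.card_Ici j ▸ hcard (Finset.Ici j) fun i hi => ?_)
    exact lt_abs.2 (.inl (habove.trans_le (sub_le_sub_right (hsort (Finset.mem_Ici.1 hi)) μ)))
  · refine (min_le_left _ _).trans (Fin.card_Iic j ▸ hcard (Finset.Iic j) fun i hi => ?_)
    exact lt_abs.2 (.inr (hbelow.trans_le
      (neg_le_neg (sub_le_sub_right (hsort (Finset.mem_Iic.1 hi)) μ))))

lemma half_le_card_farEntries {k : ℕ} (hk : 0 < k) (y : Fin k → ℝ) {μ B : ℝ}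
    (h : B < |orderStatistic y ⌈(k : ℝ) / 2⌉₊ - μ|) :
    (k : ℝ) / 2 ≤ (farEntries y μ B).card := by
  have : (0 : ℝ) < k := by exact_mod_cast hk
  set c := ⌈(k : ℝ) / 2⌉₊
  have hc0 : 0 < c := Nat.ceil_pos.2 (by positivity)
  have hc_ge : (k : ℝ) / 2 ≤ c := Nat.le_ceil _
  have hc_lt : (c : ℝ) < k / 2 + 1 := Nat.ceil_lt_add_one (by positivity)
  have hck : 2 * c < k + 2 := by
    have : 2 * (c : ℝ) < k + 2 := by linarith
    exact_mod_cast this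
  have hlt : c - 1 < k := by omega
  rw [orderStatistic, dif_pos hlt] at h
  have hmin : c ≤ (farEntries y μ B).card ∨ k + 1 ≤ (farEntries y μ B).card + c := by
    have := min_le_card_farEntries y ⟨c - 1, hlt⟩ h
    simp only at this
    omega
  rcases hmin with hmin | hmin
  · exact hc_ge.trans (by exact_mod_cast hmin)
  · have : (k : ℝ) + 1 ≤ (farEntries y μ B).card + c := by exact_mod_cast hmin
    linarith

end FarEntries

section Contamination

variable {n k m : ℕ}

/-- The action of a permutation of the sample indices on families of blocks. -/
def Blocks.permute (τ : Equiv.Perm (Fin n)) : Equiv.Perm (Blocks n k m) :=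
  (Equiv.piCongrRight fun _ => τ.finsetCongr).subtypeEquiv fun I => by
    simp [Equiv.finsetCongr_apply]

lemma blockMean_permute (τ : Equiv.Perm (Fin n)) (J : Blocks n k m) (x : Fin n → ℝ) :
    blockMean (Blocks.permute τ J) x = blockMean J (x ∘ τ) := by
  funext i
  have hblock : (Blocks.permute τ J).1 i = (J.1 i).map τ.toEmbedding := rfl
  rw [blockMean, hblock, Finset.sum_map]
  rfl

lemma IsContamination.exists_perm {α : ℝ} {xs x : Fin n → ℝ} (h : IsContamination α xs x) :
    ∃ (τ : Equiv.Perm (Fin n)) (S : Finset (Fin n)),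
      (Sᶜ.card : ℝ) ≤ α * n ∧ ∀ j ∈ S, x j = (xs ∘ τ) j := by
  obtain ⟨S, σ, hS, hσ, hx⟩ := h
  obtain ⟨g, hg⟩ := Finset.exists_equiv_extend_of_card_eq (t := (Finset.univ : Finset (Fin n)))
    (by simp) (Finset.subset_univ (S.image σ)) hσ
  refine ⟨g.trans (Equiv.subtypeUnivEquiv Finset.mem_univ), S, ?_, fun j hj => ?_⟩
  · rw [Finset.card_compl, Fintype.card_fin, Nat.cast_sub (by simpa using S.card_le_univ)]
    linarith
  · rw [hx j hj, ← hg j hj]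
    rfl

lemma card_not_subset_le {ι κ : Type*} [Fintype ι] [DecidableEq ι] [Fintype κ]
    {I : κ → Finset ι} (hI : Pairwise fun i j => Disjoint (I i) (I j)) (S : Finset ι) :
    (Finset.univ.filter fun i => ¬ I i ⊆ S).card ≤ Sᶜ.card := by
  calc (Finset.univ.filter fun i => ¬ I i ⊆ S).card
      ≤ ((Finset.univ.filter fun i => ¬ I i ⊆ S).biUnion fun i => I i \ S).card :=
        Finset.card_le_card_biUnion
          (fun i _ j _ hij => (hI hij).mono Finset.sdiff_subset Finset.sdiff_subset)
          fun i hi => Finset.sdiff_nonempty.2 (Finset.mem_filter.1 hi).2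
    _ ≤ Sᶜ.card := Finset.card_le_card <| Finset.biUnion_subset.2 fun i _ j hj =>
        Finset.mem_compl.2 (Finset.mem_sdiff.1 hj).2

lemma card_farEntries_le_add_card_compl (J : Blocks n k m) {x y : Fin n → ℝ} {S : Finset (Fin n)}
    (hxy : ∀ j ∈ S, x j = y j) (μ B : ℝ) :
    (farEntries (blockMean J x) μ B).card ≤
      (farEntries (blockMean J y) μ B).card + Sᶜ.card := by
  have hsub : farEntries (blockMean J x) μ B ⊆
      farEntries (blockMean J y) μ B ∪ Finset.univ.filter fun i => ¬ J.1 i ⊆ S := by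
    intro i hi
    by_cases hiS : J.1 i ⊆ S
    · have hmean : blockMean J x i = blockMean J y i := by
        rw [blockMean, blockMean, Finset.sum_congr rfl fun j hj => hxy j (hiS hj)]
      exact Finset.mem_union_left _ (mem_farEntries.2 (hmean ▸ mem_farEntries.1 hi))
    · exact Finset.mem_union_right _ (by simpa using hiS)
  calc (farEntries (blockMean J x) μ B).card
      ≤ _ := (Finset.card_le_card hsub).trans (Finset.card_union_le _ _)
    _ ≤ _ := Nat.add_le_add_left (card_not_subset_le J.2.2 S) _

open Classical in
/-- Counting over all families of blocks absorbs the permutation that aligns the contaminated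
sample with the clean one. -/
lemma IsContamination.card_blocks_le {α : ℝ} {xs x : Fin n → ℝ} (h : IsContamination α xs x)
    (μ B : ℝ) {s t : ℝ} (hst : t + α * n ≤ s) :
    (Finset.univ.filter fun J : Blocks n k m =>
        s ≤ (farEntries (blockMean J x) μ B).card).card ≤
      (Finset.univ.filter fun J : Blocks n k m =>
        t ≤ (farEntries (blockMean J xs) μ B).card).card := by
  obtain ⟨τ, S, hS, hxτ⟩ := h.exists_perm
  refine Finset.card_le_card_of_injOn (Blocks.permute τ) (fun J hJ => ?_)
    (Blocks.permute τ).injective.injOn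
  have hfar : ((farEntries (blockMean J x) μ B).card : ℝ) ≤
      (farEntries (blockMean J (xs ∘ τ)) μ B).card + Sᶜ.card := by
    exact_mod_cast card_farEntries_le_add_card_compl J hxτ μ B
  simp only [Finset.coe_filter, Finset.mem_univ, true_and, Set.mem_ofPred_eq,
    blockMean_permute] at hJ ⊢
  linarith

end Contamination

section RandomIndex

variable {Ω : Type*} [MeasurableSpace Ω] {P : Measure Ω} {ι : Type*} [Fintype ι]

open Classical in
lemma lintegral_card_mem {A : ι → Set Ω} (hA : ∀ i, NullMeasurableSet (A i) P) :
    ∫⁻ ω, ((Finset.univ.filter fun i => ω ∈ A i).card : ENNReal) ∂P = ∑ i, P (A i) := by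
  have hind (ω : Ω) : ((Finset.univ.filter fun i => ω ∈ A i).card : ENNReal) =
      ∑ i, (A i).indicator 1 ω := by
    simp [Set.indicator_apply, Finset.sum_boole]
  simp_rw [hind]
  rw [lintegral_finsetSum' _ fun i _ => AEMeasurable.indicator₀ (f := 1) aemeasurable_one (hA i)]
  exact Finset.sum_congr rfl fun i _ => lintegral_indicator_one₀ (hA i)

open Classical in
lemma sum_measure_le_of_card_mem_le {A A' : ι → Set Ω} (hA : ∀ i, NullMeasurableSet (A i) P)
    (hA' : ∀ i, NullMeasurableSet (A' i) P)
    (h : ∀ᵐ ω ∂P, (Finset.univ.filter fun i => ω ∈ A i).card ≤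
      (Finset.univ.filter fun i => ω ∈ A' i).card) :
    ∑ i, P (A i) ≤ ∑ i, P (A' i) := by
  rw [← lintegral_card_mem hA, ← lintegral_card_mem hA']
  refine lintegral_mono_ae ?_
  filter_upwards [h] with ω hω
  exact_mod_cast hω

lemma card_mul_measure_mem_le_sum [MeasurableSpace ι] [MeasurableSingletonClass ι] {E : Type*}
    [MeasurableSpace E] {Z : Ω → E} {I : Ω → ι} (hI : HasLaw I (uniformOn Set.univ) P)
    (hZI : IndepFun Z I P) {G : ι → Set E} (hG : ∀ i, MeasurableSet (G i)) :
    Fintype.card ι * P {ω | Z ω ∈ G (I ω)} ≤ ∑ i, P (Z ⁻¹' G i) := by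
  have hfiber (i : ι) : P (I ⁻¹' {i}) = (Fintype.card ι : ENNReal)⁻¹ := by
    rw [← Measure.map_apply_of_aemeasurable hI.aemeasurable (measurableSet_singleton i),
      hI.map_eq, uniformOn_univ, Measure.count_singleton, one_div]
  have hcover : {ω | Z ω ∈ G (I ω)} ⊆ ⋃ i ∈ Finset.univ, Z ⁻¹' G i ∩ I ⁻¹' {i} :=
    fun ω hω => Set.mem_biUnion (Finset.mem_univ (I ω)) ⟨hω, rfl⟩
  calc Fintype.card ι * P {ω | Z ω ∈ G (I ω)}
      ≤ Fintype.card ι * ∑ i, P (Z ⁻¹' G i ∩ I ⁻¹' {i}) := by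
        gcongr
        exact (measure_mono hcover).trans (measure_biUnion_finset_le _ _)
    _ = Fintype.card ι * (Fintype.card ι : ENNReal)⁻¹ * ∑ i, P (Z ⁻¹' G i) := by
        simp_rw [hZI.measure_inter_preimage_eq_mul _ _ (hG _) (measurableSet_singleton _), hfiber]
        rw [← Finset.sum_mul, mul_comm (∑ i, P (Z ⁻¹' G i)), mul_assoc]
    _ ≤ ∑ i, P (Z ⁻¹' G i) := mul_le_of_le_one_left zero_le (ENNReal.mul_inv_le_one _)

end RandomIndex

section Concentration

variable {Ω : Type*} {mΩ : MeasurableSpace Ω} {P : Measure Ω}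

lemma iIndep_iSup_of_pairwise_disjoint {ι κ : Type*} {m : ι → MeasurableSpace Ω}
    (hle : ∀ i, m i ≤ mΩ) (hm : iIndep m P) {S : κ → Set ι}
    (hS : Pairwise fun k l => Disjoint (S k) (S l)) :
    iIndep (fun k => ⨆ i ∈ S k, m i) P := by
  classical
  have : IsProbabilityMeasure P := hm.isProbabilityMeasure
  rw [iIndep_iff]
  intro t A hA
  induction t using Finset.induction_on with
  | empty => simp
  | insert k t hk ih =>
    have hdisj : Disjoint (S k) (⋃ l ∈ t, S l) :=
      Set.disjoint_iUnion₂_right.2 fun l hl => hS fun hkl => hk (hkl ▸ hl)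
    have hmono (l : κ) (hl : l ∈ t) : ⨆ i ∈ S l, m i ≤ ⨆ i ∈ ⋃ l ∈ t, S l, m i :=
      biSup_mono fun i hi => Set.mem_biUnion hl hi
    have hAt : MeasurableSet[⨆ i ∈ ⋃ l ∈ t, S l, m i] (⋂ l ∈ t, A l) :=
      Finset.measurableSet_biInter t fun l hl =>
        hmono l hl _ (hA l (Finset.mem_insert_of_mem hl))
    rw [Finset.set_biInter_insert, Finset.prod_insert hk,
      ← ih fun l hl => hA l (Finset.mem_insert_of_mem hl)]
    exact (Indep_iff _ _ _).1 (indep_iSup_of_disjoint hle hm hdisj) _ _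
      (hA k (Finset.mem_insert_self k t)) hAt

open Classical in
/-- **Hoeffding's inequality** for the number of independent events that occur. -/
lemma measureReal_le_card_mem_le {κ : Type*} [Fintype κ] {A : κ → Set Ω}
    (hA : ∀ i, MeasurableSet (A i)) (hindep : iIndepSet A P) {q t : ℝ} (ht : 0 ≤ t)
    (hq : ∀ i, P.real (A i) ≤ q) :
    P.real {ω | (q + t) * Fintype.card κ ≤ (Finset.univ.filter fun i => ω ∈ A i).card} ≤
      Real.exp (-(2 * t ^ 2 * Fintype.card κ)) := by
  have : IsProbabilityMeasure P := hindep.isProbabilityMeasure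
  let Z (i : κ) : Ω → ℝ := (A i).indicator 1
  have hmean (i : κ) : ∫ ω, Z i ω ∂P = P.real (A i) := integral_indicator_one (hA i)
  have hcentred : iIndepFun (fun i ω => Z i ω - ∫ ω, Z i ω ∂P) P :=
    hindep.iIndepFun_indicator.comp (fun i z => z - ∫ ω, Z i ω ∂P) fun i =>
      measurable_id.sub_const _
  have hsubG (i : κ) :
      HasSubgaussianMGF (fun ω => Z i ω - ∫ ω, Z i ω ∂P) ((‖(1 : ℝ) - 0‖₊ / 2) ^ 2) P :=
    hasSubgaussianMGF_of_mem_Icc (measurable_one.indicator (hA i)).aemeasurable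
      (.of_forall fun ω => by simp only [Z, Set.indicator_apply]; split_ifs <;> simp)
  have hhoeffding := HasSubgaussianMGF.measure_sum_ge_le_of_iIndepFun hcentred
    (s := Finset.univ) (fun i _ => hsubG i) (by positivity : 0 ≤ t * Fintype.card κ)
  refine (measureReal_mono fun ω hω => ?_).trans (hhoeffding.trans_eq (congrArg Real.exp ?_))
  · have hcount : ∑ i, Z i ω = (Finset.univ.filter fun i => ω ∈ A i).card := by
      simp [Z, Set.indicator_apply, Finset.sum_boole]
    have hsum : ∑ i, ∫ ω, Z i ω ∂P ≤ q * Fintype.card κ := by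
      simp_rw [hmean]
      simpa [mul_comm] using Finset.sum_le_card_nsmul Finset.univ _ q fun i _ => hq i
    simp only [Set.mem_ofPred_eq, Finset.sum_sub_distrib, hcount] at hω ⊢
    linarith
  · simp
    field_simp

end Concentration

section BlockMeans

variable {r : ℝ} {p : Measure ℝ} {n k m : ℕ}

lemma FiniteMoment.memLp_id (hr : 0 < 1 + r) (hp : FiniteMoment (1 + r) p) :
    MemLp (fun x : ℝ => x) (ENNReal.ofReal (1 + r)) p :=
  (integrable_abs_rpow_iff_memLp hr measurable_id.aestronglyMeasurable).1 hp.integrable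

lemma FiniteMoment.memLp_sub_mean (hr : 0 < 1 + r) (hp : FiniteMoment (1 + r) p) :
    MemLp (fun x => x - mean p) (ENNReal.ofReal (1 + r)) p :=
  have := hp.isProbabilityMeasure
  (hp.memLp_id hr).sub (memLp_const (mean p))

lemma FiniteMoment.integral_sub_mean (hr : 0 ≤ r) (hp : FiniteMoment (1 + r) p) :
    ∫ x, (x - mean p) ∂p = 0 := by
  have := hp.isProbabilityMeasure
  rw [integral_sub (integrable_of_memLp_one_add hr (hp.memLp_id (by linarith)))
    (integrable_const _), integral_const, probReal_univ, one_smul, mean, sub_self]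

lemma memLp_sum_sub_mean (hr : 0 < 1 + r) (hp : FiniteMoment (1 + r) p) (s : Finset (Fin n)) :
    MemLp (fun x => ∑ j ∈ s, (x j - mean p)) (ENNReal.ofReal (1 + r))
      (Measure.pi fun _ : Fin n => p) := by
  have := hp.isProbabilityMeasure
  exact memLp_finsetSum s fun j _ => (hp.memLp_sub_mean hr).comp_measurePreserving
    (measurePreserving_eval (fun _ : Fin n => p) j)

lemma integral_abs_sum_sub_mean_rpow_le (hr0 : 0 < r) (hr1 : r ≤ 1)
    (hp : FiniteMoment (1 + r) p) (s : Finset (Fin n)) :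
    ∫ x, |∑ j ∈ s, (x j - mean p)| ^ (1 + r) ∂(Measure.pi fun _ : Fin n => p) ≤
      4 * (s.card * centralMoment r p) := by
  have := hp.isProbabilityMeasure
  have heval (j : Fin n) := measurePreserving_eval (fun _ : Fin n => p) j
  have hindep : iIndepFun (fun (j : Fin n) (x : Fin n → ℝ) => x j - mean p)
      (Measure.pi fun _ => p) :=
    iIndepFun_pi (X := fun _ x => x - mean p) fun _ => (measurable_id.sub_const _).aemeasurable
  have hintegral (j : Fin n) (f : ℝ → ℝ) (hf : Measurable f) :
      ∫ x : Fin n → ℝ, f (x j) ∂(Measure.pi fun _ => p) = ∫ t, f t ∂p := by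
    have hmap := integral_map (heval j).aemeasurable (f := f) hf.aestronglyMeasurable
    rw [(heval j).map_eq] at hmap
    exact hmap.symm
  calc ∫ x, |∑ j ∈ s, (x j - mean p)| ^ (1 + r) ∂(Measure.pi fun _ : Fin n => p)
      ≤ 4 * ∑ j ∈ s, ∫ x, |x j - mean p| ^ (1 + r) ∂(Measure.pi fun _ : Fin n => p) := by
        refine integral_abs_sum_rpow_le hr0 hr1 hindep (fun j => ?_) (fun j => ?_) s
        · exact (hp.memLp_sub_mean (by linarith)).comp_measurePreserving (heval j)
        · exact (hintegral j _ (measurable_id.sub_const _)).trans (hp.integral_sub_mean hr0.le)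
    _ = 4 * (s.card * centralMoment r p) := by
        rw [Finset.sum_congr rfl fun j _ => hintegral j (fun t => |t - mean p| ^ (1 + r))
          (by fun_prop), Finset.sum_const, nsmul_eq_mul, centralMoment]

lemma measureReal_blockMean_far_le (hr0 : 0 < r) (hr1 : r ≤ 1) (hp : FiniteMoment (1 + r) p)
    (hm : 0 < m) (J : Blocks n k m) (i : Fin k) {B η : ℝ} (hB : 0 ≤ B) (hη : 0 ≤ η)
    (h : 4 * (m * centralMoment r p) ≤ η * (B * m) ^ (1 + r)) :
    (Measure.pi fun _ : Fin n => p).real {x | B < |blockMean J x i - mean p|} ≤ η := by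
  have := hp.isProbabilityMeasure
  have hm' : (0 : ℝ) < m := by exact_mod_cast hm
  have hcard : ((J.1 i).card : ℝ) = m := by exact_mod_cast J.2.1 i
  have hcentred (x : Fin n → ℝ) :
      blockMean J x i - mean p = (∑ j ∈ J.1 i, (x j - mean p)) / m := by
    rw [Finset.sum_sub_distrib, Finset.sum_const, nsmul_eq_mul, hcard, blockMean]
    field_simp
  simp_rw [hcentred, abs_div, abs_of_pos hm', lt_div_iff₀ hm']
  refine measureReal_lt_abs_le (by linarith) (memLp_sum_sub_mean (by linarith) hp _)
    (by positivity) hη (le_trans ?_ h)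
  rw [← hcard]
  exact integral_abs_sum_sub_mean_rpow_le hr0 hr1 hp _

lemma measurable_iSup_comap_blockMean (J : Blocks n k m) (i : Fin k) :
    Measurable[⨆ j ∈ (J.1 i : Set (Fin n)), MeasurableSpace.comap (Function.eval j) inferInstance]
      fun x : Fin n → ℝ => blockMean J x i :=
  (Finset.measurable_fun_sum _ fun j hj => Measurable.mono (comap_measurable (Function.eval j))
    (le_biSup (fun j => MeasurableSpace.comap (Function.eval j) _) (Finset.mem_coe.2 hj))
    le_rfl).div_const _

@[fun_prop]
lemma measurable_blockMean (J : Blocks n k m) (i : Fin k) :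
    Measurable fun x : Fin n → ℝ => blockMean J x i :=
  (Finset.measurable_fun_sum _ fun j _ => measurable_pi_apply j).div_const _

lemma iIndepFun_blockMean [IsProbabilityMeasure p] (J : Blocks n k m) :
    iIndepFun (fun i x => blockMean J x i) (Measure.pi fun _ : Fin n => p) := by
  have heval : iIndepFun (fun (j : Fin n) (x : Fin n → ℝ) => x j) (Measure.pi fun _ => p) :=
    iIndepFun_pi (X := fun _ x => x) fun _ => aemeasurable_id
  have hblocks := iIndep_iSup_of_pairwise_disjoint
    (fun j => (measurable_pi_apply j).comap_le) ((iIndepFun_iff_iIndep _ _ _).1 heval)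
    (S := fun i => (J.1 i : Set (Fin n))) fun i j hij => Finset.disjoint_coe.2 (J.2.2 hij)
  rw [iIndepFun_iff_iIndep]
  exact iIndep_iff .. |>.2 fun s A hA => hblocks.meas_biInter fun i hi =>
    (measurable_iSup_comap_blockMean J i).comap_le _ (hA i hi)

lemma measurable_card_farEntries (J : Blocks n k m) (μ B : ℝ) :
    Measurable fun x : Fin n → ℝ => ((farEntries (blockMean J x) μ B).card : ℝ) := by
  simp only [farEntries, Finset.card_filter, Nat.cast_sum]
  refine Finset.measurable_fun_sum _ fun i _ => ?_
  exact (measurable_of_countable _).comp <| Measurable.ite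
    (measurableSet_lt measurable_const (by fun_prop)) measurable_const measurable_const

lemma measureReal_le_card_farEntries_le [IsProbabilityMeasure p] (J : Blocks n k m)
    {μ B ε : ℝ} (hε : 0 ≤ ε)
    (hq : ∀ i, (Measure.pi fun _ : Fin n => p).real {x | B < |blockMean J x i - μ|} ≤ ε / 4) :
    (Measure.pi fun _ : Fin n => p).real
      {x | ε * k ≤ (farEntries (blockMean J x) μ B).card} ≤ Real.exp (-(ε ^ 2 * k)) := by
  classical
  have hfar : MeasurableSet {y : ℝ | B < |y - μ|} := measurableSet_lt (by fun_prop) (by fun_prop)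
  have hindep : iIndepSet (fun i => {x : Fin n → ℝ | B < |blockMean J x i - μ|})
      (Measure.pi fun _ => p) :=
    (iIndepSet_iff_meas_biInter fun i => measurable_blockMean J i hfar).2 fun s =>
      (iIndepFun_blockMean J).measure_inter_preimage_eq_mul s fun _ _ => hfar
  have hoeffding := measureReal_le_card_mem_le (fun i => measurable_blockMean J i hfar) hindep
    (t := 3 / 4 * ε) (by positivity) hq
  rw [Fintype.card_fin, show ε / 4 + 3 / 4 * ε = ε by ring] at hoeffding
  refine hoeffding.trans (Real.exp_le_exp.2 (neg_le_neg ?_))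
  gcongr
  nlinarith [sq_nonneg ε]

end BlockMeans

section RandomBlocks

variable {Ω : Type*} [MeasurableSpace Ω] {P : Measure Ω} {p : Measure ℝ} {α : ℝ} {n k : ℕ}
  {Xs X : Fin n → Ω → ℝ} {I : Ω → Blocks n k (n / k)}

lemma IsExperiment.map_clean [IsProbabilityMeasure P] (h : IsExperiment P p α Xs X I) :
    P.map (fun ω i => Xs i ω) = Measure.pi fun _ => p := by
  rw [h.indep.map_fun_eq_pi_map fun i => (h.law i).aemeasurable]
  simp_rw [fun i => (h.law i).map_eq]

lemma IsExperiment.measureReal_le_card_farEntries_le [IsProbabilityMeasure P]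
    (h : IsExperiment P p α Xs X I) {μ B s t η : ℝ} (hη : 0 ≤ η) (hst : t + α * n ≤ s)
    (hclean : ∀ J : Blocks n k (n / k), (Measure.pi fun _ : Fin n => p).real
      {x | t ≤ (farEntries (blockMean J x) μ B).card} ≤ η) :
    P.real {ω | s ≤ (farEntries (blockMean (I ω) fun i => X i ω) μ B).card} ≤ η := by
  classical
  have hG (J : Blocks n k (n / k)) (u : ℝ) :
      MeasurableSet {x : Fin n → ℝ | u ≤ (farEntries (blockMean J x) μ B).card} :=
    measurableSet_le measurable_const (measurable_card_farEntries J μ B)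
  have hX : AEMeasurable (fun ω i => X i ω) P := aemeasurable_pi_lambda _ h.aemeasurable
  have hXs : AEMeasurable (fun ω i => Xs i ω) P :=
    aemeasurable_pi_lambda _ fun i => (h.law i).aemeasurable
  have hcard : (Fintype.card (Blocks n k (n / k)) : ENNReal) ≠ 0 := by
    obtain ⟨ω⟩ := nonempty_of_isProbabilityMeasure P
    have : Nonempty (Blocks n k (n / k)) := ⟨I ω⟩
    exact_mod_cast Fintype.card_ne_zero
  refine ENNReal.toReal_le_of_le_ofReal hη <|
    (ENNReal.mul_le_mul_iff_right hcard (ENNReal.natCast_ne_top _)).1 ?_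
  calc Fintype.card (Blocks n k (n / k)) *
        P {ω | s ≤ (farEntries (blockMean (I ω) fun i => X i ω) μ B).card}
      ≤ ∑ J : Blocks n k (n / k),
          P {ω | s ≤ (farEntries (blockMean J fun i => X i ω) μ B).card} :=
        card_mul_measure_mem_le_sum h.blocks_law
          (h.blocks_indep.comp measurable_snd measurable_id) fun J => hG J s
    _ ≤ ∑ J : Blocks n k (n / k),
          P {ω | t ≤ (farEntries (blockMean J fun i => Xs i ω) μ B).card} := by
        refine sum_measure_le_of_card_mem_le (fun J => hX.nullMeasurable (hG J s))
          (fun J => hXs.nullMeasurable (hG J t)) ?_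
        filter_upwards [h.contamination] with ω hω
        exact hω.card_blocks_le μ B hst
    _ ≤ ∑ _J : Blocks n k (n / k), ENNReal.ofReal η := by
        refine Finset.sum_le_sum fun J _ => ?_
        have hlaw := Measure.map_apply_of_aemeasurable hXs (hG J t)
        rw [h.map_clean] at hlaw
        exact hlaw.symm.trans_le
          ((ENNReal.le_ofReal_iff_toReal_le (hlaw ▸ measure_ne_top _ _) hη).2 (hclean J))
    _ = Fintype.card (Blocks n k (n / k)) * ENNReal.ofReal η := by
        rw [Finset.sum_const, Finset.card_univ, nsmul_eq_mul]

theorem IsExperiment.one_sub_exp_le_measureReal [IsProbabilityMeasure P] {r ε B : ℝ}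
    (hr0 : 0 < r) (hr1 : r ≤ 1) (hε : 0 ≤ ε) (hB : 0 ≤ B) (hk : 0 < k) (hkn : k ≤ n)
    (hp : FiniteMoment (1 + r) p) (h : IsExperiment P p α Xs X I)
    (hcontam : ε * k + α * n ≤ k / 2)
    (hmoment : 4 * ((n / k : ℕ) * centralMoment r p) ≤ ε / 4 * (B * (n / k : ℕ)) ^ (1 + r)) :
    1 - Real.exp (-(ε ^ 2 * k)) ≤
      P.real {ω | |estimator (I ω) (fun i => X i ω) - mean p| ≤ B} := by
  have := hp.isProbabilityMeasure
  have hbad : P.real {ω | (k : ℝ) / 2 ≤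
      (farEntries (blockMean (I ω) fun i => X i ω) (mean p) B).card} ≤ Real.exp (-(ε ^ 2 * k)) :=
    h.measureReal_le_card_farEntries_le (Real.exp_nonneg _) hcontam fun J =>
      MoM.measureReal_le_card_farEntries_le J hε fun i =>
        measureReal_blockMean_far_le hr0 hr1 hp (Nat.div_pos hkn hk) J i hB (by positivity) hmoment
  have hcover : {ω | |estimator (I ω) (fun i => X i ω) - mean p| ≤ B} ∪ {ω | (k : ℝ) / 2 ≤
      (farEntries (blockMean (I ω) fun i => X i ω) (mean p) B).card} = Set.univ := by
    refine Set.eq_univ_of_forall fun ω => ?_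
    rcases le_or_gt |estimator (I ω) (fun i => X i ω) - mean p| B with hclose | hfar
    · exact .inl hclose
    · exact .inr (half_le_card_farEntries hk _ hfar)
  have hunion := measureReal_union_le (μ := P)
    {ω | |estimator (I ω) (fun i => X i ω) - mean p| ≤ B}
    {ω | (k : ℝ) / 2 ≤ (farEntries (blockMean (I ω) fun i => X i ω) (mean p) B).card}
  rw [hcover, probReal_univ] at hunion
  linarith

end RandomBlocks

section BlockCount

variable {γ δ α : ℝ} {n : ℕ}

lemma half_sub_inv_pos (hγ : 2 < γ) : 0 < 1 / 2 - 1 / γ :=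
  sub_pos.2 (one_div_lt_one_div_of_lt two_pos hγ)

lemma log_two_div_le {x : ℝ} (h : 2 * Real.exp (-x) < δ) : Real.log (2 / δ) ≤ x := by
  have hδ : 0 < δ := lt_trans (by positivity) h
  rw [Real.log_le_iff_le_exp (by positivity), div_le_iff₀ hδ]
  calc (2 : ℝ) = Real.exp x * (2 * Real.exp (-x)) := by
        rw [mul_left_comm, ← Real.exp_add, add_neg_cancel, Real.exp_zero, mul_one]
    _ ≤ Real.exp x * δ := by gcongr

lemma half_le_log_two_div (hδ0 : 0 < δ) (hδ1 : δ ≤ 1) : 1 / 2 ≤ Real.log (2 / δ) := by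
  have hlog : Real.log 2 ≤ Real.log (2 / δ) :=
    Real.log_le_log two_pos ((le_div_iff₀ hδ0).2 (by linarith))
  linarith [Real.log_two_gt_d9]

lemma log_div_sq_le_numBlocks : Real.log (2 / δ) / (1 / 2 - 1 / γ) ^ 2 ≤ numBlocks γ δ α n :=
  (Nat.le_ceil _).trans (by exact_mod_cast le_max_left _ _)

lemma mul_le_numBlocks : γ * α * n ≤ numBlocks γ δ α n :=
  (Nat.le_ceil _).trans (by exact_mod_cast le_max_right _ _)

lemma numBlocks_mul_sq_le (hγ : 2 < γ) (hδ0 : 0 < δ) (hδ1 : δ ≤ 1) (hα : 0 ≤ α) :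
    numBlocks γ δ α n * (1 / 2 - 1 / γ) ^ 2 ≤ γ * (Real.log (2 / δ) + α * n) := by
  have hε := half_sub_inv_pos hγ
  have hγ0 : 0 < 1 / γ := by positivity
  have hL := half_le_log_two_div hδ0 hδ1
  have hε2 : (1 / 2 - 1 / γ) ^ 2 ≤ (1 / 2) ^ 2 := pow_le_pow_left₀ hε.le (by linarith) 2
  set ε := 1 / 2 - 1 / γ
  set L := Real.log (2 / δ)
  have hαn : 0 ≤ γ * α * n := by positivity
  have hγL : 2 * L ≤ γ * L := by gcongr
  rw [numBlocks, Nat.cast_max, max_mul_of_nonneg _ _ (sq_nonneg ε)]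
  refine max_le ?_ ?_
  · calc (⌈L / ε ^ 2⌉₊ : ℝ) * ε ^ 2
        ≤ (L / ε ^ 2 + 1) * ε ^ 2 := by gcongr; exact (Nat.ceil_lt_add_one (by positivity)).le
      _ = L + ε ^ 2 := by field_simp
      _ ≤ γ * (L + α * n) := by linarith
  · calc (⌈γ * α * n⌉₊ : ℝ) * ε ^ 2
        ≤ (γ * α * n + 1) * ε ^ 2 := by gcongr; exact (Nat.ceil_lt_add_one hαn).le
      _ ≤ (γ * α * n + 1) * (1 / 2) ^ 2 := by gcongr
      _ ≤ γ * (L + α * n) := by linarith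

lemma numBlocks_le_sampleSize (hγ : 2 < γ) (hδ : 2 * Real.exp (-(1 / 2 - 1 / γ) ^ 2 * n) < δ)
    (hγα : γ * α ≤ 1) : numBlocks γ δ α n ≤ n := by
  refine max_le (Nat.ceil_le.2 ?_) (Nat.ceil_le.2 (mul_le_of_le_one_left n.cast_nonneg hγα))
  rw [neg_mul] at hδ
  exact (div_le_iff₀' (pow_pos (half_sub_inv_pos hγ) 2)).2 (log_two_div_le hδ)

lemma numBlocks_pos (hγ : 2 < γ) (hδ0 : 0 < δ) (hδ1 : δ ≤ 1) : 0 < numBlocks γ δ α n := by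
  have hL := half_le_log_two_div hδ0 hδ1
  exact lt_max_of_lt_left (Nat.ceil_pos.2 (div_pos (by linarith) (pow_pos (half_sub_inv_pos hγ) 2)))

lemma cast_le_two_mul_mul_div {n k : ℕ} (hk : 0 < k) (hkn : k ≤ n) :
    (n : ℝ) ≤ 2 * (k * (n / k : ℕ)) := by
  have hmod : k * (n / k) + n % k = n := Nat.div_add_mod n k
  have hlt : n % k < k := Nat.mod_lt n hk
  have hle : k ≤ k * (n / k) := Nat.le_mul_of_pos_right _ (Nat.div_pos hkn hk)
  have : n ≤ 2 * (k * (n / k)) := by omega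
  exact_mod_cast this

lemma one_le_mul_blockSize (hγ : 2 < γ) (hδ : 2 * Real.exp (-(1 / 2 - 1 / γ) ^ 2 * n) < δ)
    (hδ1 : δ ≤ 1) (hα : 0 ≤ α) (hγα : γ * α ≤ 1) :
    1 ≤ 2 * γ * ((Real.log (2 / δ) / n + α) / (1 / 2 - 1 / γ) ^ 2 *
      (n / numBlocks γ δ α n : ℕ)) := by
  have hδ0 : 0 < δ := lt_trans (by positivity) hδ
  have hε2 : 0 < (1 / 2 - 1 / γ) ^ 2 := pow_pos (half_sub_inv_pos hγ) 2
  have hk := numBlocks_pos (α := α) (n := n) hγ hδ0 hδ1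
  have hkn := numBlocks_le_sampleSize hγ hδ hγα
  have hcount := numBlocks_mul_sq_le (n := n) hγ hδ0 hδ1 hα
  have hn : (0 : ℝ) < n := by exact_mod_cast hk.trans_le hkn
  have hsize := cast_le_two_mul_mul_div hk hkn
  set k := numBlocks γ δ α n
  set m : ℝ := ((n / k : ℕ) : ℝ)
  set L := Real.log (2 / δ)
  have hkey : n * (1 / 2 - 1 / γ) ^ 2 ≤ 2 * γ * (L + α * n) * m :=
    calc n * (1 / 2 - 1 / γ) ^ 2
        ≤ 2 * (k * m) * (1 / 2 - 1 / γ) ^ 2 := by gcongr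
      _ = 2 * m * (k * (1 / 2 - 1 / γ) ^ 2) := by ring
      _ ≤ 2 * m * (γ * (L + α * n)) := by gcongr
      _ = 2 * γ * (L + α * n) * m := by ring
  calc 1 ≤ 2 * γ * (L + α * n) * m / (n * (1 / 2 - 1 / γ) ^ 2) :=
          (one_le_div (by positivity)).2 hkey
    _ = 2 * γ * ((L / n + α) / (1 / 2 - 1 / γ) ^ 2 * m) := by
        rw [show L / n + α = (L + α * n) / n by field_simp]
        generalize (1 / 2 - 1 / γ) ^ 2 = e
        ring

end BlockCount

section Rate

variable {r ε v a b c m : ℝ}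

lemma add_rpow_le_rpow_add_rpow (hr : 0 ≤ r) (ha : 0 ≤ a) (hb : 0 ≤ b) :
    (a + b) ^ r ≤ (a ^ (r / (1 + r)) + b ^ (r / (1 + r))) ^ (1 + r) := by
  have hr1 : 0 < 1 + r := by linarith
  have hsub := Real.rpow_add_le_add_rpow ha hb (by positivity : 0 ≤ r / (1 + r))
    ((div_le_one hr1).2 (by linarith))
  calc (a + b) ^ r = ((a + b) ^ (r / (1 + r))) ^ (1 + r) := by
        rw [← Real.rpow_mul (by positivity), div_mul_cancel₀ _ hr1.ne']
    _ ≤ _ := Real.rpow_le_rpow (by positivity) hsub hr1.le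

lemma one_le_mul_rpow_of_one_le_mul (hr0 : 0 ≤ r) (hr1 : r ≤ 1) (hc : 1 ≤ c) {x : ℝ} (hx : 0 ≤ x)
    (h : 1 ≤ c * x) : 1 ≤ c * x ^ r :=
  calc 1 ≤ (c * x) ^ r := Real.one_le_rpow h hr0
    _ = c ^ r * x ^ r := Real.mul_rpow (by linarith) hx
    _ ≤ c ^ (1 : ℝ) * x ^ r := by gcongr
    _ = c * x ^ r := by rw [Real.rpow_one]

/-- The exponents of `ε` in the error bound and in the number of blocks match: raised to the power
`1 + r`, the bound absorbs one factor `ε⁻¹` from the frequency `ε / 4` of far blocks, and a power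
`ε ^ (-2 r)` from the block size `m ≳ ε ^ 2 / (a + b)`. -/
lemma moment_le_rate_rpow (hr0 : 0 ≤ r) (hr1 : r ≤ 1) (hε : 0 < ε) (hv : 0 ≤ v) (ha : 0 ≤ a)
    (hb : 0 ≤ b) (hm : 0 < m) (hc : 1 ≤ c) (h : 1 ≤ c * ((a + b) / ε ^ 2 * m)) :
    4 * (m * v) ≤ ε / 4 * (16 * c * ε ^ (-((2 * r + 1) / (1 + r))) *
      (v ^ (1 / (1 + r)) * (a ^ (r / (1 + r)) + b ^ (r / (1 + r)))) * m) ^ (1 + r) := by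
  have hr : 0 < 1 + r := by linarith
  have hc16 : 16 * c ≤ (16 * c) ^ (1 + r) := Real.self_le_rpow_of_one_le (by linarith) (by linarith)
  have hε_pow : (ε ^ (-((2 * r + 1) / (1 + r)))) ^ (1 + r) = ε⁻¹ * ((ε ^ 2) ^ r)⁻¹ := by
    rw [← Real.rpow_mul hε.le, neg_mul, div_mul_cancel₀ _ hr.ne', ← Real.rpow_two,
      ← Real.rpow_mul hε.le, ← Real.rpow_neg hε.le, ← Real.rpow_neg_one, ← Real.rpow_add hε]
    ring_nf
  have hv_pow : (v ^ (1 / (1 + r))) ^ (1 + r) = v := by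
    rw [← Real.rpow_mul hv, one_div_mul_cancel hr.ne', Real.rpow_one]
  have hm_pow : m ^ (1 + r) = m * m ^ r := by rw [Real.rpow_add hm, Real.rpow_one]
  calc 4 * (m * v)
      ≤ 4 * (m * v) * (c * ((a + b) / ε ^ 2 * m) ^ r) :=
        le_mul_of_one_le_right (by positivity)
          (one_le_mul_rpow_of_one_le_mul hr0 hr1 hc (by positivity) h)
    _ = ε / 4 * (16 * c * (ε⁻¹ * ((ε ^ 2) ^ r)⁻¹) * (v * (a + b) ^ r) * (m * m ^ r)) := by
        rw [Real.mul_rpow (by positivity) hm.le, Real.div_rpow (by positivity) (by positivity)]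
        field_simp
        ring
    _ ≤ ε / 4 * ((16 * c) ^ (1 + r) * (ε⁻¹ * ((ε ^ 2) ^ r)⁻¹) *
          (v * (a ^ (r / (1 + r)) + b ^ (r / (1 + r))) ^ (1 + r)) * (m * m ^ r)) := by
        gcongr
        exact add_rpow_le_rpow_add_rpow hr0 ha hb
    _ = _ := by
        rw [← hε_pow, ← hm_pow]
        nth_rewrite 1 [← hv_pow]
        rw [← Real.mul_rpow, ← Real.mul_rpow, ← Real.mul_rpow, ← Real.mul_rpow] <;> positivity

end Rate

lemma centralMoment_nonneg (r : ℝ) (p : Measure ℝ) : 0 ≤ centralMoment r p :=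
  integral_nonneg fun _ => Real.rpow_nonneg (abs_nonneg _) _

lemma rate_nonneg {v δ α : ℝ} (hv : 0 ≤ v) (hδ : 0 ≤ Real.log (2 / δ)) (hα : 0 ≤ α) (r : ℝ)
    (n : ℕ) : 0 ≤ rate r v n δ α := by
  unfold rate; positivity

theorem IsExperiment.one_sub_le_measureReal {r : ℝ} (hr0 : 0 < r) (hr1 : r ≤ 1) {γ : ℝ}
    (hγ : 2 < γ) {n : ℕ} {δ : ℝ} (hδ : 2 * Real.exp (-(1 / 2 - 1 / γ) ^ 2 * n) < δ)
    {p : Measure ℝ} (hp : FiniteMoment (1 + r) p) {α : ℝ} (hα : 0 ≤ α) (hγα : γ * α ≤ 1)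
    {Ω : Type*} [MeasurableSpace Ω] {P : Measure Ω} [IsProbabilityMeasure P]
    {Xs X : Fin n → Ω → ℝ}
    {I : Ω → Blocks n (numBlocks γ δ α n) (n / numBlocks γ δ α n)}
    (h : IsExperiment P p α Xs X I) :
    1 - δ ≤ P.real {ω | |estimator (I ω) (fun i => X i ω) - mean p| ≤
      32 * γ * (1 / 2 - 1 / γ) ^ (-((2 * r + 1) / (1 + r))) *
        rate r (centralMoment r p) n δ α} := by
  have hδ0 : 0 < δ := lt_trans (by positivity) hδ
  rcases le_or_gt 1 δ with hδ1 | hδ1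
  · exact (sub_nonpos.2 hδ1).trans measureReal_nonneg
  have hε := half_sub_inv_pos hγ
  have hL := half_le_log_two_div hδ0 hδ1.le
  have hv := centralMoment_nonneg r p
  have hkn := numBlocks_le_sampleSize hγ hδ hγα
  have hk := numBlocks_pos (α := α) (n := n) hγ hδ0 hδ1.le
  have hm : (0 : ℝ) < (n / numBlocks γ δ α n : ℕ) := by exact_mod_cast Nat.div_pos hkn hk
  have hcontam : (1 / 2 - 1 / γ) * numBlocks γ δ α n + α * n ≤ numBlocks γ δ α n / 2 := by
    have : α * n ≤ numBlocks γ δ α n / γ :=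
      (le_div_iff₀' (by linarith)).2 ((mul_assoc ..).symm.trans_le mul_le_numBlocks)
    linarith [show (1 / 2 - 1 / γ) * (numBlocks γ δ α n : ℝ) =
      numBlocks γ δ α n / 2 - numBlocks γ δ α n / γ by ring]
  have hmoment := moment_le_rate_rpow hr0.le hr1 hε hv
    (by positivity : 0 ≤ Real.log (2 / δ) / n) hα hm (by linarith : 1 ≤ 2 * γ)
    (one_le_mul_blockSize hγ hδ hδ1.le hα hγα)
  rw [show 16 * (2 * γ) = 32 * γ by ring] at hmoment
  have hexp : Real.exp (-((1 / 2 - 1 / γ) ^ 2 * numBlocks γ δ α n)) ≤ δ := by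
    rw [← Real.le_log_iff_exp_le hδ0]
    have := (div_le_iff₀' (pow_pos hε 2)).1
      (log_div_sq_le_numBlocks (γ := γ) (δ := δ) (α := α) (n := n))
    rw [Real.log_div two_ne_zero hδ0.ne'] at this
    linarith [Real.log_pos one_lt_two]
  have hrate := rate_nonneg hv (by linarith : 0 ≤ Real.log (2 / δ)) hα r n
  exact (sub_le_sub_left hexp 1).trans
    (h.one_sub_exp_le_measureReal hr0 hr1 hε.le (by positivity) hk hkn hp hcontam hmoment)

section Bernoulli

variable {r a : ℝ} {q : unitInterval}

lemma finiteMoment_bernoulliMeasure (s : ℝ) (a : ℝ) (q : unitInterval) :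
    FiniteMoment s Ber(a, 0, q) :=
  ⟨inferInstance, integrable_bernoulliMeasure ..⟩

lemma mean_bernoulliMeasure (a : ℝ) (q : unitInterval) : mean Ber(a, 0, q) = q * a := by
  simp [mean, integral_bernoulliMeasure]

lemma centralMoment_bernoulliMeasure (r a : ℝ) (q : unitInterval) :
    centralMoment r Ber(a, 0, q) =
      (q * (1 - q) ^ (1 + r) + (1 - q) * (q : ℝ) ^ (1 + r)) * |a| ^ (1 + r) := by
  have hq := unitInterval.nonneg q
  have hq' := unitInterval.one_minus_nonneg q
  rw [centralMoment, mean_bernoulliMeasure, integral_bernoulliMeasure, smul_eq_mul, smul_eq_mul,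
    zero_sub, abs_neg, show a - q * a = (1 - q) * a by ring, abs_mul, abs_mul, abs_of_nonneg hq,
    abs_of_nonneg hq', Real.mul_rpow hq' (abs_nonneg a), Real.mul_rpow hq (abs_nonneg a)]
  ring

lemma exists_centralMoment_bernoulliMeasure_eq (hr : 0 ≤ r) (hq0 : 0 < q) (hq1 : q < 1) {v : ℝ}
    (hv : 0 < v) : ∃ a > 0, v ^ (1 / (1 + r)) * (q : ℝ) ^ (r / (1 + r)) ≤ 2 * (q * a) ∧
      ∀ b, |b| = a → centralMoment r Ber(b, 0, q) = v := by
  have hr1 : 0 < 1 + r := by linarith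
  have hq0 : (0 : ℝ) < q := hq0
  have hq1 : (0 : ℝ) < 1 - q := sub_pos.2 hq1
  set w := q * (1 - q) ^ (1 + r) + (1 - q) * (q : ℝ) ^ (1 + r) with hw
  have hw0 : 0 < w := by positivity
  have hwq : w ≤ 2 * q := by
    have h1 : (1 - q : ℝ) ^ (1 + r) ≤ 1 := Real.rpow_le_one hq1.le (by linarith) hr1.le
    have h2 : (q : ℝ) ^ (1 + r) ≤ q :=
      Real.rpow_le_self_of_le_one hq0.le (by linarith) (by linarith)
    calc w ≤ q * 1 + 1 * q := by rw [hw]; gcongr; linarith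
      _ = 2 * q := by ring
  have hroot : ((v / w) ^ (1 / (1 + r))) ^ (1 + r) = v / w := by
    rw [← Real.rpow_mul (by positivity), one_div_mul_cancel hr1.ne', Real.rpow_one]
  refine ⟨(v / w) ^ (1 / (1 + r)), by positivity, ?_, fun b hb => ?_⟩
  · refine (Real.rpow_le_rpow_iff (by positivity) (by positivity) hr1).1 ?_
    calc (v ^ (1 / (1 + r)) * (q : ℝ) ^ (r / (1 + r))) ^ (1 + r) = v * q ^ r := by
          rw [Real.mul_rpow (by positivity) (by positivity), ← Real.rpow_mul hv.le,
            ← Real.rpow_mul hq0.le, one_div_mul_cancel hr1.ne', div_mul_cancel₀ _ hr1.ne',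
            Real.rpow_one]
      _ = w * q ^ r * (v / w) := by field_simp
      _ ≤ 2 * q * q ^ r * (v / w) := by gcongr
      _ = 2 * (q ^ (1 + r) * (v / w)) := by rw [Real.rpow_add hq0, Real.rpow_one]; ring
      _ ≤ 2 ^ (1 + r) * (q ^ (1 + r) * (v / w)) := by
          gcongr
          exact Real.self_le_rpow_of_one_le one_le_two (by linarith)
      _ = (2 * (q * (v / w) ^ (1 / (1 + r)))) ^ (1 + r) := by
          rw [Real.mul_rpow two_pos.le (by positivity), Real.mul_rpow hq0.le (by positivity), hroot]
  · rw [centralMoment_bernoulliMeasure, hb, hroot, mul_div_cancel₀ _ hw0.ne']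

end Bernoulli

section EraseAttack

variable {n : ℕ} {α : ℝ}

/-- The adversarial attack that replaces the sample by `0` if at most `α n` of its entries are
non-zero, and leaves it unchanged otherwise. -/
noncomputable def eraseAttack (α : ℝ) (x : Fin n → ℝ) : Fin n → ℝ :=
  if (hammingNorm x : ℝ) ≤ α * n then 0 else x

lemma measurable_hammingNorm {ι : Type*} [Fintype ι] {β : ι → Type*} [∀ i, Zero (β i)]
    [∀ i, DecidableEq (β i)] [∀ i, MeasurableSpace (β i)] [∀ i, MeasurableSingletonClass (β i)] :
    Measurable (hammingNorm : (∀ i, β i) → ℕ) := by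
  change Measurable fun x : ∀ i, β i => hammingNorm x
  simp only [hammingNorm, Finset.card_filter]
  exact Finset.measurable_fun_sum _ fun i _ => Measurable.ite
    (measurable_pi_apply i (measurableSet_singleton 0).compl) measurable_const measurable_const

lemma measurable_eraseAttack (α : ℝ) : Measurable (eraseAttack (n := n) α) :=
  Measurable.ite (measurableSet_le (measurable_from_top.comp measurable_hammingNorm)
    measurable_const) measurable_const measurable_id

lemma isContamination_eraseAttack (hα : 0 ≤ α) (x : Fin n → ℝ) :
    IsContamination α x (eraseAttack α x) := by
  by_cases h : (hammingNorm x : ℝ) ≤ α * n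
  · refine ⟨Finset.univ.filter fun i => x i = 0, id, ?_, Set.injOn_id _, fun i hi => ?_⟩
    · have hcard : ((Finset.univ.filter fun i => x i = 0).card : ℝ) + hammingNorm x = n := by
        have := Finset.card_filter_add_card_filter_not (s := Finset.univ) fun i => x i = 0
        rw [Finset.card_fin] at this
        exact_mod_cast this
      linarith
    · simp_all [eraseAttack]
  · refine ⟨Finset.univ, id, ?_, Set.injOn_id _, fun i _ => by simp [eraseAttack, h]⟩
    rw [Finset.card_fin]
    exact mul_le_of_le_one_left n.cast_nonneg (by linarith)

variable (p : Measure ℝ) [IsProbabilityMeasure p]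

lemma pow_le_measureReal_eraseAttack_eq_zero (n : ℕ) (α : ℝ) :
    p.real {0} ^ n ≤ (Measure.pi fun _ : Fin n => p).real {x | eraseAttack α x = 0} :=
  calc p.real {0} ^ n = (Measure.pi fun _ : Fin n => p).real {0} := by
        simp [measureReal_def, Measure.pi_singleton]
    _ ≤ _ := measureReal_mono fun x hx => by simp [Set.mem_singleton_iff.1 hx, eraseAttack]

lemma integrable_hammingNorm (n : ℕ) :
    Integrable (fun x => (hammingNorm x : ℝ)) (Measure.pi fun _ : Fin n => p) :=
  Integrable.of_bound (measurable_from_top.comp measurable_hammingNorm).aestronglyMeasurable n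
    (.of_forall fun x => by
      simpa using (hammingNorm_le_card_fintype (x := x)))

lemma integral_hammingNorm (n : ℕ) :
    ∫ x, (hammingNorm x : ℝ) ∂(Measure.pi fun _ : Fin n => p) = n * p.real {0}ᶜ := by
  have hS : MeasurableSet ({0}ᶜ : Set ℝ) := (measurableSet_singleton 0).compl
  have hmp := measurePreserving_eval fun _ : Fin n => p
  calc ∫ x, (hammingNorm x : ℝ) ∂(Measure.pi fun _ : Fin n => p)
      = ∫ x, ∑ i, (Function.eval i ⁻¹' {0}ᶜ).indicator 1 x ∂(Measure.pi fun _ : Fin n => p) := by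
        simp [hammingNorm, Finset.card_filter, Set.indicator]
    _ = ∑ i, (Measure.pi fun _ : Fin n => p).real (Function.eval i ⁻¹' {0}ᶜ) := by
        rw [integral_finsetSum _ fun i _ =>
          (integrable_const 1).indicator ((hmp i).measurable hS)]
        simp only [integral_indicator_one ((hmp _).measurable hS)]
    _ = n * p.real {0}ᶜ := by
        simp only [(hmp _).measureReal_preimage hS.nullMeasurableSet, Finset.sum_const,
          Finset.card_fin, nsmul_eq_mul]

lemma half_le_measureReal_eraseAttack_eq_zero (hα : 0 < α) (hp : p.real {0}ᶜ ≤ α / 2) {n : ℕ}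
    (hn : 0 < n) :
    1 / 2 ≤ (Measure.pi fun _ : Fin n => p).real {x | eraseAttack α x = 0} := by
  set Q := Measure.pi fun _ : Fin n => p
  have : (0 : ℝ) < n := Nat.cast_pos.2 hn
  have hmarkov : Q.real {x | α * n ≤ hammingNorm x} ≤ 1 / 2 := by
    have h := mul_meas_ge_le_integral_of_nonneg (μ := Q) (f := fun x => (hammingNorm x : ℝ))
      (.of_forall fun x => Nat.cast_nonneg _) (integrable_hammingNorm p n) (α * n)
    rw [integral_hammingNorm] at h
    refine le_of_mul_le_mul_left (h.trans ?_) (by positivity : 0 < α * n)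
    calc n * p.real {0}ᶜ ≤ n * (α / 2) := by gcongr
      _ = α * n * (1 / 2) := by ring
  have hcover : {x | eraseAttack α x = 0} ∪ {x : Fin n → ℝ | α * n ≤ hammingNorm x} = Set.univ :=
    Set.eq_univ_of_forall fun x => (le_total (hammingNorm x : ℝ) (α * n)).imp (if_pos ·) id
  have hunion := measureReal_union_le (μ := Q) {x | eraseAttack α x = 0}
    {x : Fin n → ℝ | α * n ≤ hammingNorm x}
  rw [hcover, probReal_univ] at hunion
  linarith

end EraseAttack

lemma exp_neg_two_mul_le_one_sub {q : ℝ} (hq0 : 0 ≤ q) (hq1 : q ≤ 1 / 2) :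
    Real.exp (-(2 * q)) ≤ 1 - q := by
  rw [Real.exp_neg, inv_le_iff_one_le_mul₀ (Real.exp_pos _)]
  calc 1 ≤ (1 - q) * (2 * q + 1) := by nlinarith
    _ ≤ (1 - q) * Real.exp (2 * q) := by
        gcongr
        · linarith
        · exact Real.add_one_le_exp _

/-- The level `q` is the larger of `α / 2`, so that Markov's inequality bounds the number of
non-zero entries by `α n`, and `log (1 / (2 δ)) / (2 n)`, so that no entry is non-zero with
probability `2 δ`. -/
lemma exists_level_le_measureReal_eraseAttack_eq_zero {n : ℕ} {δ : ℝ} (hδ : Real.exp (-n) ≤ δ)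
    (hδ' : δ ≤ 1 / 4) {α : ℝ} (hα : α ≤ 1) :
    ∃ q : unitInterval, 0 < q ∧ q < 1 ∧ Real.log (2 / δ) / n ≤ 6 * q ∧ α ≤ 2 * q ∧
      ∀ (p : Measure ℝ) [IsProbabilityMeasure p], p.real {0}ᶜ = q →
        2 * δ ≤ (Measure.pi fun _ : Fin n => p).real {x | eraseAttack α x = 0} := by
  have hδ0 : 0 < δ := (Real.exp_pos _).trans_le hδ
  have hn : 0 < n := Nat.pos_of_ne_zero fun h => by norm_num [h] at hδ; linarith
  have : (0 : ℝ) < n := Nat.cast_pos.2 hn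
  set l := Real.log (1 / (2 * δ)) with hl
  have hl0 : 0 < l := Real.log_pos ((one_lt_div (by positivity)).2 (by linarith))
  have hexp : 2 * δ = Real.exp (-l) := by
    rw [Real.exp_neg, hl, Real.exp_log (by positivity), one_div, inv_inv]
  have hln : l ≤ n := neg_le_neg_iff.1 (Real.exp_le_exp.1 (by linarith))
  have hlog : Real.log (2 / δ) ≤ 3 * l := by
    have hcube : 2 / δ ≤ (1 / (2 * δ)) ^ 3 := by
      rw [div_pow, div_le_div_iff₀ hδ0 (by positivity)]
      nlinarith [mul_pos hδ0 hδ0]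
    calc Real.log (2 / δ) ≤ Real.log ((1 / (2 * δ)) ^ 3) := Real.log_le_log (by positivity) hcube
      _ = 3 * l := by rw [Real.log_pow, ← hl, Nat.cast_ofNat]
  set q := max (l / (2 * n)) (α / 2)
  have hlq : l / (2 * n) ≤ q := le_max_left ..
  have hαq : α / 2 ≤ q := le_max_right ..
  have hq0 : 0 < q := lt_max_of_lt_left (by positivity)
  have hq1 : q ≤ 1 / 2 := max_le ((div_le_iff₀ (by positivity)).2 (by linarith)) (by linarith)
  refine ⟨⟨q, hq0.le, by linarith⟩, hq0, show q < 1 by linarith, ?_, show α ≤ 2 * q by linarith,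
    fun p _ hp => ?_⟩
  · rw [div_le_iff₀ (by positivity)] at hlq ⊢
    exact hlog.trans (by linarith)
  · rcases max_choice (l / (2 * n)) (α / 2) with h | h
    · calc 2 * δ = Real.exp (-(2 * q)) ^ n := by
            rw [hexp, ← Real.exp_nat_mul, show q = _ from h]
            field_simp
        _ ≤ (1 - q) ^ n := by gcongr; exact exp_neg_two_mul_le_one_sub hq0.le hq1
        _ = p.real {0} ^ n := by
            rw [← show p.real {0}ᶜ = q from hp,
              probReal_compl_eq_one_sub (measurableSet_singleton 0), sub_sub_cancel]
        _ ≤ _ := pow_le_measureReal_eraseAttack_eq_zero p n α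
    · have hqα : q = α / 2 := h
      exact le_trans (by linarith) (half_le_measureReal_eraseAttack_eq_zero p (by linarith)
        (hp.trans hqα).le hn)

lemma half_le_measureReal_or_half_le_measureReal {E : Type*} [PseudoMetricSpace E]
    [MeasurableSpace E] (ν : Measure E) [IsProbabilityMeasure ν] {x y : E} {d : ℝ}
    (h : 2 * d ≤ dist x y) :
    1 / 2 ≤ ν.real {t | d ≤ dist t x} ∨ 1 / 2 ≤ ν.real {t | d ≤ dist t y} := by
  by_contra! hfar
  have hcover : {t | d ≤ dist t x} ∪ {t | d ≤ dist t y} = Set.univ := by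
    refine Set.eq_univ_of_forall fun t => ?_
    by_contra! ht
    simp only [Set.mem_union, Set.mem_ofPred_eq, not_or, not_le] at ht
    linarith [dist_triangle_left x y t]
  have hunion := measureReal_union_le (μ := ν) {t | d ≤ dist t x} {t | d ≤ dist t y}
  rw [hcover, probReal_univ] at hunion
  linarith

lemma mul_measureReal_le_comp_map {Ω α β : Type*} [MeasurableSpace Ω] [MeasurableSpace α]
    [MeasurableSpace β] {Q : Measure Ω} [IsProbabilityMeasure Q] {κ : Kernel α β}
    [IsMarkovKernel κ] {A : Ω → α} (hA : Measurable A) (z : α) {s : Set β}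
    (hs : MeasurableSet s) :
    (κ z).real s * Q.real {x | A x = z} ≤ (κ ∘ₘ Q.map A).real s := by
  have : IsProbabilityMeasure (Q.map A) := Measure.isProbabilityMeasure_map hA.aemeasurable
  simp only [measureReal_def, ← ENNReal.toReal_mul]
  refine ENNReal.toReal_mono (measure_ne_top _ _) ?_
  calc κ z s * Q {x | A x = z} ≤ κ z s * Q {x | κ z s ≤ κ (A x) s} := by
        gcongr with x
        rintro rfl
        exact le_rfl
    _ ≤ ∫⁻ x, κ (A x) s ∂Q :=
        mul_meas_ge_le_lintegral₀ ((κ.measurable_coe hs).comp hA).aemeasurable _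
    _ = (κ ∘ₘ Q.map A) s := by
        rw [Measure.bind_apply hs κ.aemeasurable, lintegral_map (κ.measurable_coe hs) hA]

lemma rate_le_mul_rpow {r v q δ α b c : ℝ} {n : ℕ} (hr : 0 ≤ r) (hv : 0 ≤ v) (hq : 0 ≤ q)
    (hb : 1 ≤ b) (hc : 1 ≤ c) (hδ : 0 ≤ Real.log (2 / δ)) (hδq : Real.log (2 / δ) / n ≤ b * q)
    (hα : 0 ≤ α) (hαq : α ≤ c * q) :
    rate r v n δ α ≤ (b + c) * (v ^ (1 / (1 + r)) * q ^ (r / (1 + r))) := by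
  have : 0 ≤ r / (1 + r) := by positivity
  have hr1 : r / (1 + r) ≤ 1 := (div_le_one (by linarith)).2 (by linarith)
  have hpow {x d : ℝ} (hx : 0 ≤ x) (hd : 1 ≤ d) (h : x ≤ d * q) :
      x ^ (r / (1 + r)) ≤ d * q ^ (r / (1 + r)) :=
    calc x ^ (r / (1 + r)) ≤ (d * q) ^ (r / (1 + r)) := by gcongr
      _ = d ^ (r / (1 + r)) * q ^ (r / (1 + r)) := Real.mul_rpow (by linarith) hq
      _ ≤ d * q ^ (r / (1 + r)) := by gcongr; exact Real.rpow_le_self_of_one_le hd hr1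
  calc rate r v n δ α ≤ v ^ (1 / (1 + r)) * (b * q ^ (r / (1 + r)) + c * q ^ (r / (1 + r))) := by
        unfold rate
        gcongr
        · exact hpow (by positivity) hb hδq
        · exact hpow hα hc hαq
    _ = _ := by ring

theorem exists_attack {r : ℝ} (hr : 0 < r) {n : ℕ} {δ : ℝ} (hδ : Real.exp (-n) ≤ δ)
    (hδ' : δ ≤ 1 / 4) {α : ℝ} (hα0 : 0 ≤ α) (hα1 : α ≤ 1) {v : ℝ} (hv : 0 < v)
    (κ : Kernel (Fin n → ℝ) ℝ) [IsMarkovKernel κ] :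
    ∃ p : Measure ℝ, FiniteMoment (1 + r) p ∧ centralMoment r p = v ∧
      ∃ A : (Fin n → ℝ) → (Fin n → ℝ), Measurable A ∧ (∀ xs, IsContamination α xs (A xs)) ∧
        δ ≤ (κ ∘ₘ (Measure.pi fun _ => p).map A).real
          {t : ℝ | 1 / 16 * rate r v n δ α ≤ |t - mean p|} := by
  have hδ0 : 0 < δ := (Real.exp_pos _).trans_le hδ
  have hL := half_le_log_two_div hδ0 (by linarith)
  obtain ⟨q, hq0, hq1, hδq, hαq, herase⟩ :=
    exists_level_le_measureReal_eraseAttack_eq_zero hδ hδ' hα1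
  obtain ⟨a, ha, hva, hmoment⟩ := exists_centralMoment_bernoulliMeasure_eq hr.le hq0 hq1 hv
  have hrate := rate_le_mul_rpow hr.le hv.le (unitInterval.nonneg q) (by norm_num) one_le_two
    (by linarith) hδq hα0 hαq
  have hsep : 2 * (1 / 16 * rate r v n δ α) ≤
      dist (mean Ber(a, 0, q)) (mean Ber(-a, 0, q)) := by
    rw [mean_bernoulliMeasure, mean_bernoulliMeasure, Real.dist_eq]
    exact le_trans (by linarith) (le_abs_self _)
  obtain ⟨b, hb, hfar⟩ : ∃ b, |b| = a ∧
      1 / 2 ≤ (κ 0).real {t | 1 / 16 * rate r v n δ α ≤ |t - mean Ber(b, 0, q)|} := by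
    rcases half_le_measureReal_or_half_le_measureReal (κ 0) hsep with h | h
    · exact ⟨a, abs_of_pos ha, h⟩
    · exact ⟨-a, by rw [abs_neg, abs_of_pos ha], h⟩
  have hb0 : b ≠ 0 := abs_pos.1 (hb ▸ ha)
  refine ⟨Ber(b, 0, q), finiteMoment_bernoulliMeasure _ b q, hmoment b hb, eraseAttack α,
    measurable_eraseAttack α, isContamination_eraseAttack hα0, ?_⟩
  have hzero := herase Ber(b, 0, q) (bernoulliMeasure_real_apply_of_mem_of_notMem q
    (measurableSet_singleton 0).compl hb0 (by simp))
  calc δ = 1 / 2 * (2 * δ) := by ring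
    _ ≤ _ := mul_le_mul hfar hzero (by positivity) measureReal_nonneg
    _ ≤ _ := mul_measureReal_le_comp_map (measurable_eraseAttack α) 0
        (measurableSet_le measurable_const (measurable_id.sub_const _).abs)

end MoM

open MoM in
theorem theorem3p3_general (r : ℝ) (hr0 : 0 < r) :
    (r ≤ 1 → ∀ γ : ℝ, 2 < γ →
      ∀ (n : ℕ) (δ : ℝ), 2 * Real.exp (-(1 / 2 - 1 / γ) ^ 2 * n) < δ →
      ∀ p : Measure ℝ, FiniteMoment (1 + r) p →
      ∀ α : ℝ, 0 ≤ α → γ * α ≤ 1 →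
      ∀ (Ω : Type*) [MeasurableSpace Ω] (P : Measure Ω) [IsProbabilityMeasure P]
        (Xs X : Fin n → Ω → ℝ)
        (I : Ω → Blocks n (numBlocks γ δ α n) (n / numBlocks γ δ α n)),
        IsExperiment P p α Xs X I →
        1 - δ ≤ P.real {ω | |estimator (I ω) (fun i => X i ω) - mean p| ≤
          32 * γ * (1 / 2 - 1 / γ) ^ (-((2 * r + 1) / (1 + r))) *
            rate r (centralMoment r p) n δ α}) ∧
    (∀ (n : ℕ) (δ : ℝ), Real.exp (-n) ≤ δ → δ ≤ 1 / 4 →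
      ∀ α : ℝ, 0 ≤ α → α ≤ 1 →
      ∀ v : ℝ, 0 < v →
      ∀ (κ : Kernel (Fin n → ℝ) ℝ) [IsMarkovKernel κ],
      ∃ p : Measure ℝ, FiniteMoment (1 + r) p ∧ centralMoment r p = v ∧
      ∃ A : (Fin n → ℝ) → (Fin n → ℝ), Measurable A ∧ (∀ xs, IsContamination α xs (A xs)) ∧
        δ ≤ (κ ∘ₘ (Measure.pi fun _ => p).map A).real
          {t : ℝ | 1 / 16 * rate r v n δ α ≤ |t - mean p|}) :=
  ⟨fun hr1 _ hγ _ _ hδ _ hp _ hα hγα _ _ _ _ _ _ _ h =>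
    h.one_sub_le_measureReal hr0 hr1 hγ hδ hp hα hγα,
  fun _ _ hδ hδ' _ hα0 hα1 _ hv κ _ => exists_attack hr0 hδ hδ' hα0 hα1 hv κ⟩

/-- First part: the error bound for median-of-means. Second part: no estimator, even a randomized
one (a Markov kernel `κ` from contaminated samples to estimates) that knows `r`, `v`, `n`, `δ`
and `α`, has an error of smaller order over the distributions with absolute central moment `v`;
here `A` is the adversarial attack, and `κ ∘ₘ (Measure.pi fun _ => p).map A` is the law of the
estimate. -/
theorem theorem3p3 (r : ℝ) (hr0 : 0 < r) (hr1 : r < 1) :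
    (∃ C : ℝ → ℝ,
      (∃ c₁ c₂ : ℝ, 0 < c₁ ∧ 0 < c₂ ∧ ∀ γ : ℝ, 2 < γ → γ ≤ 2.5 →
        c₁ * (1 / 2 - 1 / γ) ^ (-((2 * r + 1) / (1 + r))) ≤ C γ ∧
        C γ ≤ c₂ * (1 / 2 - 1 / γ) ^ (-((2 * r + 1) / (1 + r)))) ∧
      ∀ (γ : ℝ), 2 < γ → γ ≤ 2.5 →
      ∀ (n : ℕ) (δ : ℝ), 2 * Real.exp (-(1 / 2 - 1 / γ) ^ 2 * n) < δ →
      ∀ (p : Measure ℝ), MoM.FiniteMoment (1 + r) p →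
      ∀ (α : ℝ), 0 ≤ α → α ≤ 0.4 →
      ∀ (Ω : Type*) [MeasurableSpace Ω] (P : Measure Ω) [IsProbabilityMeasure P]
        (Xs X : Fin n → Ω → ℝ)
        (I : Ω → MoM.Blocks n (MoM.numBlocks γ δ α n) (n / MoM.numBlocks γ δ α n)),
        MoM.IsExperiment P p α Xs X I →
        1 - δ ≤ P.real {ω | |MoM.estimator (I ω) (fun i => X i ω) - MoM.mean p| ≤
          C γ * MoM.rate r (MoM.centralMoment r p) n δ α}) ∧
    (∃ c : ℝ, 0 < c ∧
      ∀ (n : ℕ) (δ : ℝ), Real.exp (-n) ≤ δ → δ ≤ 1 / 4 →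
      ∀ (α : ℝ), 0 ≤ α → α ≤ 0.4 →
      ∀ (v : ℝ), 0 < v →
      ∀ (κ : Kernel (Fin n → ℝ) ℝ) [IsMarkovKernel κ],
      ∃ p : Measure ℝ, MoM.FiniteMoment (1 + r) p ∧ MoM.centralMoment r p = v ∧
      ∃ A : (Fin n → ℝ) → (Fin n → ℝ), Measurable A ∧ (∀ xs, MoM.IsContamination α xs (A xs)) ∧
        δ ≤ (κ ∘ₘ (Measure.pi fun _ => p).map A).real
          {t : ℝ | c * MoM.rate r v n δ α ≤ |t - MoM.mean p|}) := by
  obtain ⟨hupper, hlower⟩ := theorem3p3_general r hr0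
  refine ⟨⟨fun γ => 32 * γ * (1 / 2 - 1 / γ) ^ (-((2 * r + 1) / (1 + r))), ⟨64, 80, by norm_num,
    by norm_num, fun γ hγ hγ' => ?_⟩, fun γ hγ hγ' n δ hδ p hp α hα hα' =>
      hupper hr1.le γ hγ n δ hδ p hp α hα ?_⟩, 1 / 16, by norm_num,
    fun n δ hδ hδ' α hα hα' => hlower n δ hδ hδ' α hα (hα'.trans (by norm_num))⟩
  · have := MoM.half_sub_inv_pos hγ
    beta_reduce
    constructor <;> gcongr <;> norm_num at hγ' ⊢ <;> linarith
  · calc γ * α ≤ 2.5 * 0.4 := by gcongr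
      _ = 1 := by norm_num
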